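/- Let $n\ge 0$ be an integer, let $\mathcal{F}=\Gamma_s(L^2(\mathbb{R}_+;\mathbb{C}^n))$ be the symmetric Fock space with exponential vectors $e(f)=\bigoplus_{p\ge 0}(p!)^{-1/2}f^{\otimes p}$, and for $t\ge 0$ let $\mathcal{F}_{t]}\subset\mathcal{F}$ be the closed linear span of the vectors $e(f)$ with $f$ supported in $[0,t]$. For $\psi\in\mathcal{F}_{h]}$ and an integer $m\ge 0$ let $\psi^{\otimes m}\in\mathcal{F}_{mh]}\subset\mathcal{F}$ be the tensor product of $m$ copies of $\psi$ placed in the consecutive time slices $[(j-1)h,jh]$, $j=1,\dots,m$, with respect to the continuous tensor product structure $e(f)\otimes e(g)\mapsto e(f+\theta_s^*g)$ of $\mathcal{F}$, where $f$ is supported in $[0,s]$ and $(\theta_s^*g)(t)=g(t-s)$ for $t\ge s$ and $0$ for $t<s$. Let $\mathcal{K}$ be a complex Hilbert space and let $\pi^k:\mathcal{K}\to\mathcal{F}_{2^{-k}]}$, $k\in\mathbb{N}$, be linear isometries. Suppose that $\chi_0,\dots,\chi_n$ and $\tilde\chi_0,\dots,\tilde\chi_n$ are two orthonormal families in $\mathcal{K}$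 such that for every $\alpha\in\mathbb{C}^n$, as $k\to\infty$, $$\Bigl(\pi^k\bigl(\chi_0+2^{-k/2}\sum_{j=1}^n\alpha_j\chi_j\bigr)\Bigr)^{\otimes 2^k}\to e(\alpha I_{[0,1]}) \quad\text{and}\quad \Bigl(\pi^k\bigl(\tilde\chi_0+2^{-k/2}\sum_{j=1}^n\alpha_j\tilde\chi_j\bigr)\Bigr)^{\otimes 2^k}\to e(\alpha I_{[0,1]})$$ in the norm of $\mathcal{F}$. Then there is a $\phi\in\mathbb{R}$ such that $\tilde\chi_j=e^{i\phi}\chi_j$ for all $j=0,\dots,n$. -/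

import Mathlib

open MeasureTheory
open scoped NNReal TensorProduct

noncomputable section
namespace QFock
section General
variable {X : Type*} [MeasurableSpace X] (μ : Measure X) [SigmaFinite μ]

/-- The `p`-fold Hilbert tensor power of `L²(X, μ)`, realised as `L²(X^p, μ^p)`. -/
abbrev NParticle (p : ℕ) : Type _ :=
  Lp ℂ 2 (Measure.pi fun _ : Fin p => μ)

/-- Permuting coordinates preserves the product measure. -/
theorem measurePreserving_perm (p : ℕ) (σ : Equiv.Perm (Fin p)) :
    MeasurePreserving (fun (x : Fin p → X) i => x (σ i))
      (Measure.pi fun _ : Fin p => μ) (Measure.pi fun _ : Fin p => μ) := by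
  have h := measurePreserving_piCongrLeft (fun _ : Fin p => μ) σ.symm
  convert h using 1
  ext x i
  have := MeasurableEquiv.piCongrLeft_apply_apply (β := fun _ : Fin p => X) (e := σ.symm) x (σ i)
  simpa using this.symm

/-- The `p`-fold symmetric tensor power of `L²(X, μ)`: the square integrable functions of `p`
variables that are invariant under all permutations of the variables. -/
def symSubspace (p : ℕ) : Submodule ℂ (NParticle μ p) where
  carrier := {ψ | ∀ σ : Equiv.Perm (Fin p),
    Lp.compMeasurePreserving _ (measurePreserving_perm μ p σ) ψ = ψ}
  add_mem' := by
    intro a b ha hb σ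
    rw [map_add, ha σ, hb σ]
  zero_mem' := by
    intro σ
    rw [map_zero]
  smul_mem' := by
    intro c a ha σ
    have := (Lp.compMeasurePreservingₗ ℂ _ (measurePreserving_perm μ p σ)
      (E := ℂ) (p := 2)).map_smul c a
    exact this.trans (congrArg (c • ·) (ha σ))

instance (p : ℕ) : CompleteSpace (symSubspace μ p) := by
  have : IsClosed (symSubspace μ p : Set (NParticle μ p)) := by
    have h : (symSubspace μ p : Set (NParticle μ p)) = ⋂ σ : Equiv.Perm (Fin p),
        {ψ | Lp.compMeasurePreserving _ (measurePreserving_perm μ p σ) ψ = ψ} := by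
      ext ψ
      rw [Set.mem_iInter]
      rfl
    rw [h]
    exact isClosed_iInter fun σ => isClosed_eq
      (Lp.isometry_compMeasurePreserving (measurePreserving_perm μ p σ)).continuous continuous_id
  exact this.completeSpace_coe

/-- The symmetric (boson) Fock space over `L²(X, μ)`: the Hilbert sum over `p : ℕ` of the
symmetric tensor powers. -/
def Fock : Type _ := lp (fun p : ℕ => symSubspace μ p) 2

instance : NormedAddCommGroup (Fock μ) :=
  inferInstanceAs (NormedAddCommGroup (lp (fun p : ℕ => symSubspace μ p) 2))

instance : InnerProductSpace ℂ (Fock μ) :=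
  inferInstanceAs (InnerProductSpace ℂ (lp (fun p : ℕ => symSubspace μ p) 2))

instance : CompleteSpace (Fock μ) :=
  inferInstanceAs (CompleteSpace (lp (fun p : ℕ => symSubspace μ p) 2))

variable {μ}

theorem memLp_prod (f : Lp ℂ 2 μ) (p : ℕ) :
    MemLp (fun x : Fin p → X => ∏ i, f (x i)) 2 (Measure.pi fun _ : Fin p => μ) := by
  have hm : AEStronglyMeasurable (fun x : Fin p → X => ∏ i, f (x i))
      (Measure.pi fun _ : Fin p => μ) := by
    refine Finset.aestronglyMeasurable_fun_prod _ fun i _ => ?_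
    exact (Lp.aestronglyMeasurable f).comp_quasiMeasurePreserving
      (Measure.quasiMeasurePreserving_eval _ i)
  rw [memLp_two_iff_integrable_sq_norm hm]
  have h : Integrable (fun x => ‖f x‖ ^ 2) μ :=
    (memLp_two_iff_integrable_sq_norm (Lp.aestronglyMeasurable f)).1 (Lp.memLp f)
  have := Integrable.fintype_prod (ι := Fin p) (f := fun _ x => ‖f x‖ ^ 2) (μ := fun _ => μ)
    (fun _ => h)
  simpa [norm_prod, Finset.prod_pow] using this

/-- The symmetric tensor `f ⊗ ⋯ ⊗ f` (`p` factors), i.e. `x ↦ f (x 0) ⋯ f (x (p - 1))`. -/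
def particlePow (f : Lp ℂ 2 μ) (p : ℕ) : symSubspace μ p :=
  ⟨(memLp_prod f p).toLp, by
    intro σ
    rw [Lp.toLp_compMeasurePreserving]
    congr 1
    ext x
    exact Equiv.prod_comp σ fun i => f (x i)⟩

theorem inner_particlePow (f g : Lp ℂ 2 μ) (p : ℕ) :
    inner ℂ (particlePow f p) (particlePow g p) = (inner ℂ f g) ^ p := by
  rw [Submodule.coe_inner, L2.inner_def, L2.inner_def]
  have h := integral_fintype_prod_eq_prod (𝕜 := ℂ) (ι := Fin p) (μ := fun _ => μ)
    (fun _ x => inner ℂ (f x) (g x))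
  rw [Finset.prod_const, Finset.card_univ, Fintype.card_fin] at h
  rw [← h]
  refine integral_congr_ae ?_
  filter_upwards [(memLp_prod f p).coeFn_toLp, (memLp_prod g p).coeFn_toLp] with x hx hy
  simp only [particlePow]
  rw [hx, hy]
  simp [Finset.prod_mul_distrib]

theorem norm_particlePow (f : Lp ℂ 2 μ) (p : ℕ) : ‖particlePow f p‖ = ‖f‖ ^ p := by
  have h := (inner_self_eq_norm_sq_to_K (𝕜 := ℂ) (particlePow f p)).symm.trans (inner_particlePow f f p)
  rw [inner_self_eq_norm_sq_to_K, ← pow_mul, mul_comm 2 p, pow_mul] at h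
  have h2 : (‖particlePow f p‖) ^ 2 = (‖f‖ ^ p) ^ 2 := by exact_mod_cast h
  exact (sq_eq_sq₀ (norm_nonneg _) (by positivity)).1 h2

theorem expVec_mem (f : Lp ℂ 2 μ) :
    Memℓp (fun p : ℕ => ((Real.sqrt p.factorial : ℂ))⁻¹ • particlePow f p) 2 := by
  refine memℓp_gen ?_
  have h := Real.summable_pow_div_factorial (‖f‖ ^ 2)
  refine h.congr fun p => ?_
  rw [norm_smul, norm_particlePow]
  simp only [ENNReal.toReal_ofNat, Real.rpow_ofNat, norm_inv, Complex.norm_real, Real.norm_eq_abs,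
    mul_pow, inv_pow, sq_abs, Real.sq_sqrt (Nat.cast_nonneg (α := ℝ) p.factorial)]
  ring

/-- The exponential vector `e(f) = ⨁ₚ (p!)^{-1/2} f^{⊗p}`. -/
def expVec (f : Lp ℂ 2 μ) : Fock μ :=
  ⟨fun p : ℕ => ((Real.sqrt p.factorial : ℂ))⁻¹ • particlePow f p, expVec_mem f⟩

/-- `⟨e(f), e(g)⟩ = exp ⟨f, g⟩`. -/
theorem inner_expVec (f g : Lp ℂ 2 μ) :
    inner ℂ (expVec f) (expVec g) = Complex.exp (inner ℂ f g) := by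
  refine (lp.inner_eq_tsum (𝕜 := ℂ) (G := fun p : ℕ => symSubspace μ p) (expVec f) (expVec g)).trans ?_
  rw [Complex.exp_eq_exp_ℂ, NormedSpace.exp_eq_tsum_div]
  refine tsum_congr fun p => ?_
  have h1 : ∀ (c : ℂ) (u v : symSubspace μ p), inner ℂ (c • u) (c • v)
      = (starRingEnd ℂ) c * (c * inner ℂ u v) := fun c u v => by
    exact (inner_smul_left u (c • v) c).trans (congrArg _ (inner_smul_right u v c))
  simp only [expVec]
  refine (h1 _ _ _).trans ?_
  rw [inner_particlePow, map_inv₀, Complex.conj_ofReal,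
    ← mul_assoc, ← mul_inv, ← Complex.ofReal_mul, Real.mul_self_sqrt (Nat.cast_nonneg _)]
  simp [div_eq_inv_mul]

end General

section Isometry
variable {E F ι : Type*} [NormedAddCommGroup E] [InnerProductSpace ℂ E]
  [NormedAddCommGroup F] [InnerProductSpace ℂ F] [CompleteSpace F]

/-- A total family can be mapped isometrically to any family with the same Gram matrix. -/
theorem exists_isometry_of_gram (v : ι → E) (w : ι → F)
    (hG : ∀ i j, inner ℂ (v i) (v j) = inner ℂ (w i) (w j))
    (hv : Dense (Submodule.span ℂ (Set.range v) : Set E)) :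
    ∃ V : E →ₗᵢ[ℂ] F, ∀ i, V (v i) = w i := by
  set e := Finsupp.linearCombination ℂ v with he
  set f := Finsupp.linearCombination ℂ w with hf
  have hinner : ∀ x y, inner ℂ (e x) (e y) = inner ℂ (f x) (f y) := by
    intro x y
    simp only [he, hf, Finsupp.linearCombination_apply, Finsupp.sum, sum_inner, inner_sum,
      inner_smul_left, inner_smul_right, hG]
  have hnorm : ∀ x, ‖f x‖ = ‖e x‖ := by
    intro x
    rw [norm_eq_sqrt_re_inner (𝕜 := ℂ), norm_eq_sqrt_re_inner (𝕜 := ℂ), hinner]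
  have hd : DenseRange e := by
    have h : Set.range e = (Submodule.span ℂ (Set.range v) : Set E) := by
      rw [← Finsupp.range_linearCombination]
      rfl
    rw [DenseRange, h]
    exact hv
  have hb : ∃ C, ∀ x, ‖f x‖ ≤ C * ‖e x‖ := ⟨1, fun x => by rw [one_mul, hnorm]⟩
  have hext := LinearMap.extendOfNorm_eq (f := f) (e := e) hd hb
  refine ⟨⟨(f.extendOfNorm e : E →L[ℂ] F).toLinearMap, ?_⟩, ?_⟩
  · intro x
    refine hd.induction_on (p := fun x => ‖f.extendOfNorm e x‖ = ‖x‖) x ?_ ?_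
    · exact isClosed_eq (by fun_prop) (by fun_prop)
    · intro c
      rw [hext, hnorm]
  · intro i
    have := hext (Finsupp.single i 1)
    simpa [he, hf] using this

theorem dense_span_tmul {G κ : Type*} [NormedAddCommGroup G] [InnerProductSpace ℂ G]
    (v : ι → E) (w : κ → G)
    (hv : Dense (Submodule.span ℂ (Set.range v) : Set E))
    (hw : Dense (Submodule.span ℂ (Set.range w) : Set G)) :
    Dense (Submodule.span ℂ (Set.range fun p : ι × κ => v p.1 ⊗ₜ[ℂ] w p.2) :
      Set (E ⊗[ℂ] G)) := by
  set S := Submodule.span ℂ (Set.range fun p : ι × κ => v p.1 ⊗ₜ[ℂ] w p.2)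
  have hc : ∀ a : E, ∀ b : G, a ⊗ₜ[ℂ] b ∈ S.topologicalClosure := by
    have h1 : ∀ a ∈ Submodule.span ℂ (Set.range v), ∀ b ∈ Submodule.span ℂ (Set.range w),
        a ⊗ₜ[ℂ] b ∈ S := by
      intro a ha b hb
      induction ha using Submodule.span_induction with
      | mem a ha =>
        obtain ⟨i, rfl⟩ := ha
        induction hb using Submodule.span_induction with
        | mem b hb =>
          obtain ⟨j, rfl⟩ := hb
          exact Submodule.subset_span ⟨(i, j), rfl⟩
        | zero => simp
        | add b b' _ _ h h' => rw [TensorProduct.tmul_add]; exact S.add_mem h h'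
        | smul c b _ h => rw [TensorProduct.tmul_smul]; exact S.smul_mem c h
      | zero => simp
      | add a a' _ _ h h' => rw [TensorProduct.add_tmul]; exact S.add_mem h h'
      | smul c a _ h => rw [← TensorProduct.smul_tmul']; exact S.smul_mem c h
    intro a b
    have := (hv.prod hw) (a, b)
    exact map_mem_closure (f := fun x : E × G => x.1 ⊗ₜ[ℂ] x.2) TensorProduct.continuous_tmul
      this fun x hx => h1 x.1 hx.1 x.2 hx.2
  rw [Submodule.dense_iff_topologicalClosure_eq_top, eq_top_iff]
  rintro x -
  induction x with
  | zero => exact Submodule.zero_mem _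
  | tmul a b => exact hc a b
  | add a b ha hb => exact Submodule.add_mem _ ha hb

end Isometry

section Time

/-- Lebesgue measure on `ℝ₊` times counting measure on the `n` channels. -/
def modeMeasure (n : ℕ) : Measure (ℝ × Fin n) :=
  (volume.restrict (Set.Ici (0 : ℝ))).prod Measure.count

instance (n : ℕ) : SigmaFinite (modeMeasure n) := by
  unfold modeMeasure
  infer_instance

/-- The one-particle space `L²(ℝ₊; ℂⁿ) ≅ L²(ℝ₊ × {1, …, n})`, where `f (t, i)` is the `i`-th
component of `f t`. -/
abbrev OneParticle (n : ℕ) : Type := Lp ℂ 2 (modeMeasure n)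

/-- The symmetric Fock space over `L²(ℝ₊; ℂⁿ)`. -/
abbrev FockSpace (n : ℕ) : Type := Fock (modeMeasure n)

variable {n : ℕ}

/-- `f` vanishes almost everywhere outside the time interval `[0, t]`. -/
def SupportedUpTo (t : ℝ≥0) (f : OneParticle n) : Prop :=
  ∀ᵐ x ∂modeMeasure n, (t : ℝ) < x.1 → f x = 0

theorem measurePreserving_sub (n : ℕ) (s : ℝ≥0) :
    MeasurePreserving (fun x : ℝ × Fin n => (x.1 - s, x.2))
      ((modeMeasure n).restrict {x | (s : ℝ) ≤ x.1}) (modeMeasure n) := by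
  have h1 : (modeMeasure n).restrict {x | (s : ℝ) ≤ x.1}
      = (volume.restrict (Set.Ici (s : ℝ))).prod Measure.count := by
    have : {x : ℝ × Fin n | (s : ℝ) ≤ x.1} = Set.Ici (s : ℝ) ×ˢ Set.univ := by
      ext x
      simp
    rw [this, modeMeasure, ← Measure.prod_restrict, Measure.restrict_univ,
      Measure.restrict_restrict measurableSet_Ici, Set.Ici_inter_Ici]
    congr 3
    exact sup_of_le_left s.2
  rw [h1, modeMeasure]
  have h2 : MeasurePreserving (fun t : ℝ => t - s) (volume.restrict (Set.Ici (s : ℝ)))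
      (volume.restrict (Set.Ici (0 : ℝ))) := by
    have h := (measurePreserving_sub_right (volume : Measure ℝ) (s : ℝ)).restrict_preimage
      (measurableSet_Ici (a := (0 : ℝ)))
    have h3 : (fun t : ℝ => t - s) ⁻¹' Set.Ici 0 = Set.Ici (s : ℝ) := by
      ext t
      simp
    rwa [h3] at h
  exact h2.prod (MeasurePreserving.id _)

theorem measurableSet_ge (n : ℕ) (s : ℝ≥0) : MeasurableSet {x : ℝ × Fin n | (s : ℝ) ≤ x.1} :=
  measurableSet_le measurable_const measurable_fst

theorem memLp_shift (s : ℝ≥0) (f : OneParticle n) :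
    MemLp (Set.indicator {x : ℝ × Fin n | (s : ℝ) ≤ x.1} fun x => f (x.1 - s, x.2)) 2
      (modeMeasure n) := by
  rw [memLp_indicator_iff_restrict (measurableSet_ge n s)]
  exact (Lp.memLp f).comp_measurePreserving (measurePreserving_sub n s)

/-- The forward time shift: `(shift s f)(t) = f (t - s)` for `t ≥ s` and `0` for `t < s`.
This is the adjoint of `f ↦ f (s + ·)`, an isometry onto the functions supported in `[s, ∞)`. -/
def shift (s : ℝ≥0) (f : OneParticle n) : OneParticle n :=
  (memLp_shift s f).toLp

theorem inner_shift (s : ℝ≥0) (f g : OneParticle n) :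
    inner ℂ (shift s f) (shift s g) = inner ℂ f g := by
  rw [L2.inner_def, L2.inner_def]
  have h := (measurePreserving_sub n s)
  have h3 : ∫ x, inner ℂ (f x) (g x) ∂modeMeasure n
      = ∫ x in {x : ℝ × Fin n | (s : ℝ) ≤ x.1},
        inner ℂ (f (x.1 - s, x.2)) (g (x.1 - s, x.2)) ∂modeMeasure n := by
    have hm : AEStronglyMeasurable (fun x => inner ℂ (f x) (g x)) (Measure.map
        (fun x : ℝ × Fin n => (x.1 - s, x.2))
        ((modeMeasure n).restrict {x | (s : ℝ) ≤ x.1})) := by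
      rw [h.map_eq]
      exact (L2.integrable_inner f g).aestronglyMeasurable
    have hi := integral_map h.aemeasurable hm
    rwa [h.map_eq] at hi
  rw [h3, ← integral_indicator (measurableSet_ge n s)]
  refine integral_congr_ae ?_
  filter_upwards [(memLp_shift s f).coeFn_toLp, (memLp_shift s g).coeFn_toLp] with x hx hy
  rw [shift, shift, hx, hy]
  by_cases hs : (s : ℝ) ≤ x.1 <;> simp [hs]

theorem inner_shift_eq_zero {s : ℝ≥0} {f : OneParticle n} (hf : SupportedUpTo s f)
    (g : OneParticle n) : inner ℂ f (shift s g) = 0 := by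
  rw [L2.inner_def]
  refine integral_eq_zero_of_ae ?_
  have hne : ∀ᵐ x ∂modeMeasure n, x.1 ≠ (s : ℝ) := by
    have h : ∀ᵐ t ∂(volume.restrict (Set.Ici (0 : ℝ))), t ≠ (s : ℝ) :=
      ae_restrict_of_ae (Measure.ae_ne _ _)
    exact Measure.quasiMeasurePreserving_fst.ae h
  filter_upwards [hf, hne, (memLp_shift s g).coeFn_toLp] with x hx hn hy
  rw [shift, hy]
  rcases lt_or_gt_of_ne hn with h | h
  · simp [not_le.2 h]
  · simp [hx h]

theorem SupportedUpTo.add_shift {s t : ℝ≥0} {f g : OneParticle n} (hf : SupportedUpTo s f)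
    (hg : SupportedUpTo t g) : SupportedUpTo (s + t) (f + shift s g) := by
  have h := (ae_restrict_iff' (measurableSet_ge n s)).1
    ((measurePreserving_sub n s).quasiMeasurePreserving.ae hg)
  filter_upwards [hf, h, (memLp_shift s g).coeFn_toLp, Lp.coeFn_add f (shift s g)]
    with x h1 h2 h3 h4 h5
  push_cast at h5
  have hs : (s : ℝ) < x.1 := by linarith [t.2]
  rw [h4, Pi.add_apply, h1 hs, shift, h3, Set.indicator_of_mem (by exact hs.le), zero_add]
  exact h2 hs.le (by linarith)

theorem inner_add_shift {s : ℝ≥0} {f f' : OneParticle n} (hf : SupportedUpTo s f)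
    (hf' : SupportedUpTo s f') (g g' : OneParticle n) :
    inner ℂ (f + shift s g) (f' + shift s g') = inner ℂ f f' + inner ℂ g g' := by
  rw [inner_add_left, inner_add_right, inner_add_right, inner_shift,
    inner_shift_eq_zero hf, ← inner_conj_symm (shift s g) f', inner_shift_eq_zero hf']
  simp

/-- The Fock space of the time interval `[0, t]`, as a closed subspace of the whole Fock space
(a vector of the former is identified with its tensor product with the vacuum of `[t, ∞)`):
the closed linear span of the `e(f)` with `f` supported in `[0, t]`. -/
def past (n : ℕ) (t : ℝ≥0) : Submodule ℂ (FockSpace n) :=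
  (Submodule.span ℂ {ψ | ∃ f : OneParticle n, SupportedUpTo t f ∧ expVec f = ψ}).topologicalClosure

instance (t : ℝ≥0) : CompleteSpace (past n t) :=
  (Submodule.isClosed_topologicalClosure _).completeSpace_coe

/-- The exponential vector `e(f)`, `f` supported in `[0, t]`, as an element of `past n t`. -/
def pastExpVec (t : ℝ≥0) (f : {f : OneParticle n // SupportedUpTo t f}) : past n t :=
  ⟨expVec f.1, Submodule.le_topologicalClosure _ (Submodule.subset_span ⟨f.1, f.2, rfl⟩)⟩

theorem dense_pastExpVec (n : ℕ) (t : ℝ≥0) :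
    Dense (Submodule.span ℂ (Set.range (pastExpVec (n := n) t)) : Set (past n t)) := by
  have hmap : (Submodule.span ℂ (Set.range (pastExpVec (n := n) t))).map (past n t).subtype
      = Submodule.span ℂ {ψ | ∃ f : OneParticle n, SupportedUpTo t f ∧ expVec f = ψ} := by
    rw [Submodule.map_span, ← Set.range_comp]
    congr 1
    ext ψ
    simp [pastExpVec]
  intro x
  rw [closure_subtype]
  have h2 : (x : FockSpace n) ∈ closure ((Submodule.span ℂ (Set.range
      (pastExpVec (n := n) t))).map (past n t).subtype : Set (FockSpace n)) := by
    rw [hmap]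
    exact x.2
  exact h2

theorem inner_pastExpVec (t : ℝ≥0) (f g : {f : OneParticle n // SupportedUpTo t f}) :
    inner ℂ (pastExpVec t f) (pastExpVec t g) = Complex.exp (inner ℂ f.1 g.1) :=
  inner_expVec f.1 g.1

theorem gram_concat (s t : ℝ≥0)
    (p q : {f : OneParticle n // SupportedUpTo s f} × {g : OneParticle n // SupportedUpTo t g}) :
    inner ℂ (pastExpVec s p.1 ⊗ₜ[ℂ] pastExpVec t p.2) (pastExpVec s q.1 ⊗ₜ[ℂ] pastExpVec t q.2)
      = inner ℂ (pastExpVec (s + t) ⟨p.1.1 + shift s p.2.1, p.1.2.add_shift p.2.2⟩)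
        (pastExpVec (s + t) ⟨q.1.1 + shift s q.2.1, q.1.2.add_shift q.2.2⟩) := by
  rw [TensorProduct.inner_tmul, inner_pastExpVec, inner_pastExpVec, inner_pastExpVec,
    inner_add_shift p.1.2 q.1.2, Complex.exp_add]

/-- There is exactly one isometry as described in `concat`. -/
theorem existsUnique_concat (n : ℕ) (s t : ℝ≥0) :
    ∃! V : past n s ⊗[ℂ] past n t →ₗᵢ[ℂ] past n (s + t),
      ∀ (f : {f : OneParticle n // SupportedUpTo s f})
        (g : {g : OneParticle n // SupportedUpTo t g}),
        V (pastExpVec s f ⊗ₜ pastExpVec t g)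
          = pastExpVec (s + t) ⟨f.1 + shift s g.1, f.2.add_shift g.2⟩ := by
  have hd := dense_span_tmul _ _ (dense_pastExpVec n s) (dense_pastExpVec n t)
  obtain ⟨V, hV⟩ := exists_isometry_of_gram _ _ (gram_concat (n := n) s t) hd
  refine ⟨V, fun f g => hV (f, g), fun W hW => ?_⟩
  have hclm : W.toContinuousLinearMap = V.toContinuousLinearMap := by
    refine ContinuousLinearMap.ext_on hd ?_
    rintro _ ⟨p, rfl⟩
    exact (hW p.1 p.2).trans (hV p).symm
  ext1 x
  exact DFunLike.congr_fun hclm x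

/-- The continuous tensor product identification of `past n s ⊗ past n t` inside `past n (s + t)`:
the second factor is shifted in time by `s` and placed right after the first one. It is the unique
linear isometry with `e(f) ⊗ e(g) ↦ e(f + shift s g)`. -/
def concat (n : ℕ) (s t : ℝ≥0) : past n s ⊗[ℂ] past n t →ₗᵢ[ℂ] past n (s + t) :=
  (existsUnique_concat n s t).choose

theorem concat_tmul (s t : ℝ≥0) (f : {f : OneParticle n // SupportedUpTo s f})
    (g : {g : OneParticle n // SupportedUpTo t g}) :
    concat n s t (pastExpVec s f ⊗ₜ pastExpVec t g)
      = pastExpVec (s + t) ⟨f.1 + shift s g.1, f.2.add_shift g.2⟩ :=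
  (existsUnique_concat n s t).choose_spec.1 f g

theorem inner_concat (s t : ℝ≥0) (x y : past n s ⊗[ℂ] past n t) :
    inner ℂ (concat n s t x) (concat n s t y) = inner ℂ x y :=
  LinearIsometry.inner_map_map (𝕜 := ℂ) (concat n s t) x y

theorem supportedUpTo_zero (t : ℝ≥0) : SupportedUpTo t (0 : OneParticle n) := by
  filter_upwards [Lp.coeFn_zero ℂ 2 (modeMeasure n)] with x hx _
  exact hx

/-- `ψ^{⊗m}` for a vector `ψ` of the Fock space of a time slice of length `h`: the tensor product of
`m` copies of `ψ`, placed in the `m` consecutive time slices `[j h, (j + 1) h]`, `j < m`. For `m = 0`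
it is the vacuum `e(0)`. -/
def sliceTensorPow {h : ℝ≥0} (ψ : past n h) : (m : ℕ) → past n (m • h)
  | 0 => pastExpVec _ ⟨0, supportedUpTo_zero _⟩
  | m + 1 => ⟨concat n (m • h) h (sliceTensorPow ψ m ⊗ₜ ψ), by
      rw [succ_nsmul]
      exact Subtype.property _⟩

/-- The function `(t, i) ↦ a i` for `t ∈ [0, 1]`, and `0` for other `t`. -/
def unitPulseFun (a : Fin n → ℂ) (x : ℝ × Fin n) : ℂ :=
  Set.indicator (Set.Icc (0 : ℝ) 1) (fun _ => a x.2) x.1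

theorem memLp_unitPulseFun (a : Fin n → ℂ) : MemLp (unitPulseFun a) 2 (modeMeasure n) := by
  have h : unitPulseFun a = Set.indicator (Set.Icc (0 : ℝ) 1 ×ˢ Set.univ) fun x => a x.2 := by
    ext x
    by_cases hx : x.1 ∈ Set.Icc (0 : ℝ) 1 <;> simp [unitPulseFun, Set.indicator, hx, Set.mem_prod]
  have hm : MeasurableSet (Set.Icc (0 : ℝ) 1 ×ˢ (Set.univ : Set (Fin n))) :=
    measurableSet_Icc.prod MeasurableSet.univ
  rw [h, memLp_indicator_iff_restrict hm, modeMeasure, ← Measure.prod_restrict,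
    Measure.restrict_univ, Measure.restrict_restrict measurableSet_Icc]
  have : IsFiniteMeasure (volume.restrict (Set.Icc (0 : ℝ) 1 ∩ Set.Ici 0)) :=
    ⟨by
      rw [Measure.restrict_apply_univ]
      exact (measure_mono Set.inter_subset_left).trans_lt measure_Icc_lt_top⟩
  obtain ⟨C, hC⟩ := (Set.finite_range fun i => ‖a i‖).bddAbove
  refine MemLp.of_bound
    ((measurable_of_countable a).comp measurable_snd).aestronglyMeasurable C ?_
  exact Filter.Eventually.of_forall fun x => hC ⟨x.2, rfl⟩

/-- The element `a I_{[0,1]}` of `L²(ℝ₊; ℂⁿ)`. -/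
def unitPulse (a : Fin n → ℂ) : OneParticle n :=
  (memLp_unitPulseFun a).toLp

/-- `χ^k(a) = χ₀ + 2^{-k/2} ∑ⱼ aⱼ χⱼ`, for a family `χ₀, …, χₙ` and `a ∈ ℂⁿ`. -/
def noiseVec {K : Type*} [NormedAddCommGroup K] [InnerProductSpace ℂ K]
    (χ : Fin (n + 1) → K) (k : ℕ) (a : Fin n → ℂ) : K :=
  χ 0 + (((2 : ℝ) ^ (-(k : ℝ) / 2) : ℝ) : ℂ) • ∑ j : Fin n, a j • χ j.succ

/-- For every `a ∈ ℂⁿ`, the vectors `(π^k χ^k(a))^{⊗ 2^k}` converge in the Fock space to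
`e(a I_{[0,1]})` as `k → ∞`. -/
def ConvergesToExp {K : Type*} [NormedAddCommGroup K] [InnerProductSpace ℂ K]
    (π : (k : ℕ) → K →ₗᵢ[ℂ] past n ((2 : ℝ≥0)⁻¹ ^ k)) (χ : Fin (n + 1) → K) : Prop :=
  ∀ a : Fin n → ℂ,
    Filter.Tendsto
      (fun k : ℕ => (sliceTensorPow (π k (noiseVec χ k a)) (2 ^ k) : FockSpace n))
      Filter.atTop (nhds (expVec (unitPulse a)))

end Time
end QFock
end

namespace QFock

/-! Tensor powers turn inner products into powers, and each `π k` is isometric. Pairing the two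
convergence hypotheses therefore removes the Fock space: `⟨χ^k(a), χ'^k(b)⟩ ^ 2^k → exp ⟨a, b⟩`, a
statement about vectors of `K` alone (`tendsto_inner_noiseVec_pow`).

At `a = b = 0` it says `c ^ 2^k → 1` for `c = ⟨χ 0, χ' 0⟩`. Hence `‖c‖ = 1`, and equality in
Cauchy–Schwarz gives `χ' 0 = c • χ 0`. Orthogonality then kills the cross terms, so the inner
product is `c + s / 2^k = c (1 + (s / c) / 2^k)`, with `s` the pairing of `∑ aⱼ χⱼ` and `∑ bⱼ χ'ⱼ`.
Its `2^k`-th power tends to `exp (s / c)`, so `exp (s / c) = exp ⟨a, b⟩`. Real scaling of `b`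
removes the `2πi` ambiguity, giving `⟨χⱼ, χ'ⱼ⟩ = c`, and Cauchy–Schwarz applies again with the same
phase. -/

/-! ### Scalar limits and the equality case of Cauchy–Schwarz -/

theorem norm_eq_one_of_tendsto_pow {c : ℂ} {N : ℕ → ℕ}
    (hN : Filter.Tendsto N Filter.atTop Filter.atTop) (hc : ‖c‖ ≤ 1)
    (h : Filter.Tendsto (fun k => c ^ N k) Filter.atTop (nhds 1)) : ‖c‖ = 1 := by
  refine hc.antisymm (not_lt.1 fun hlt => ?_)
  exact one_ne_zero
    (tendsto_nhds_unique h ((tendsto_pow_atTop_nhds_zero_of_norm_lt_one hlt).comp hN))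

/-- Two complex numbers whose real multiples have the same exponentials agree. -/
theorem eq_of_forall_exp_mul_eq {z w : ℂ}
    (h : ∀ t : ℝ, Complex.exp (t * z) = Complex.exp (t * w)) : z = w := by
  -- A single `t` determines the exponent only modulo `2πi`; the derivative at `t = 0` determines it
  -- exactly.
  have hd : ∀ u : ℂ, HasDerivAt (fun t : ℝ => Complex.exp (t * u)) u 0 := fun u => by
    have h1 : HasDerivAt (fun t : ℝ => (t : ℂ) * u) (1 * u) 0 :=
      (Complex.ofRealCLM.hasDerivAt (x := (0 : ℝ))).mul_const u
    simpa using h1.cexp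
  exact (hd z).unique (by simpa only [h] using hd w)

/-- Equality case of Cauchy–Schwarz: `c • x` and `y` are unit vectors with inner product `conj c * c
= 1`. -/
theorem eq_smul_of_inner_eq {E : Type*} [NormedAddCommGroup E] [InnerProductSpace ℂ E]
    {x y : E} {c : ℂ} (hx : ‖x‖ = 1) (hy : ‖y‖ = 1) (hc : ‖c‖ = 1) (h : inner ℂ x y = c) :
    y = c • x := by
  refine ((inner_eq_one_iff_of_norm_eq_one (𝕜 := ℂ) (by rw [norm_smul, hc, hx, one_mul]) hy).1
    ?_).symm
  rw [inner_smul_left, h, Complex.conj_mul', hc]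
  simp

/-! ### Inner products of tensor powers, pulses and noise vectors -/

variable {n : ℕ}

/-- Each slice contributes one factor, because `concat` is isometric and inner products multiply on
pure tensors; the vacuum contributes `exp 0 = 1`. -/
theorem inner_sliceTensorPow {h : ℝ≥0} (ψ φ : past n h) (m : ℕ) :
    inner ℂ (sliceTensorPow ψ m : FockSpace n) (sliceTensorPow φ m : FockSpace n)
      = inner ℂ ψ φ ^ m := by
  induction m with
  | zero =>
    rw [pow_zero]
    exact (inner_pastExpVec _ _ _).trans (by simp)
  | succ m ih =>
    rw [pow_succ, ← ih]
    exact (inner_concat (m • h) h (sliceTensorPow ψ m ⊗ₜ ψ) (sliceTensorPow φ m ⊗ₜ φ)).trans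
      (TensorProduct.inner_tmul (𝕜 := ℂ) _ _ _ _)

/-- The pulses are constant in time on an interval of length one, so the time integral contributes a
factor `1`. -/
theorem inner_unitPulse (a b : Fin n → ℂ) :
    inner ℂ (unitPulse a) (unitPulse b) = ∑ j, inner ℂ (a j) (b j) := by
  rw [L2.inner_def]
  have h : ∀ᵐ x ∂modeMeasure n, inner ℂ (unitPulse a x) (unitPulse b x)
      = (Set.Icc (0 : ℝ) 1 ×ˢ Set.univ).indicator (fun x => inner ℂ (a x.2) (b x.2)) x := by
    filter_upwards [(memLp_unitPulseFun a).coeFn_toLp, (memLp_unitPulseFun b).coeFn_toLp]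
      with x hx hy
    rw [unitPulse, unitPulse, hx, hy]
    by_cases h : x.1 ∈ Set.Icc (0 : ℝ) 1 <;>
      simp [unitPulseFun, Set.indicator, h, Set.mem_prod]
  rw [integral_congr_ae h, integral_indicator (measurableSet_Icc.prod MeasurableSet.univ),
    modeMeasure, ← Measure.prod_restrict, Measure.restrict_univ,
    Measure.restrict_restrict measurableSet_Icc, Set.inter_eq_left.2 Set.Icc_subset_Ici_self]
  have hp := integral_prod_mul (μ := volume.restrict (Set.Icc (0 : ℝ) 1))
    (ν := (Measure.count : Measure (Fin n))) (fun _ : ℝ => (1 : ℂ))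
    (fun i => inner ℂ (a i) (b i))
  simpa [integral_count] using hp

/-- The scaling `2^{-k/2}` occurs once in each argument, which yields the `1 / 2^k` matched to the
exponent `2^k` in the limit. -/
theorem inner_noiseVec {K : Type*} [NormedAddCommGroup K] [InnerProductSpace ℂ K]
    {χ χ' : Fin (n + 1) → K} (hl : ∀ j : Fin n, inner ℂ (χ 0) (χ' j.succ) = 0)
    (hr : ∀ j : Fin n, inner ℂ (χ j.succ) (χ' 0) = 0) (k : ℕ) (a b : Fin n → ℂ) :
    inner ℂ (noiseVec χ k a) (noiseVec χ' k b) = inner ℂ (χ 0) (χ' 0)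
      + inner ℂ (∑ j, a j • χ j.succ) (∑ j, b j • χ' j.succ) / (2 ^ k : ℕ) := by
  have h1 : inner ℂ (χ 0) (∑ j, b j • χ' j.succ) = 0 := by
    simp [hl]
  have h2 : inner ℂ (∑ j, a j • χ j.succ) (χ' 0) = 0 := by
    simp [hr]
  have h3 : ((2 : ℝ) ^ (-(k : ℝ) / 2)) * (2 : ℝ) ^ (-(k : ℝ) / 2) = ((2 : ℝ) ^ k)⁻¹ := by
    rw [← Real.rpow_add two_pos, add_halves, Real.rpow_neg two_pos.le, Real.rpow_natCast]
  rw [noiseVec, noiseVec, inner_add_left, inner_add_right, inner_add_right, inner_smul_left,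
    inner_smul_left, inner_smul_right, inner_smul_right, h1, h2, Complex.conj_ofReal, ← mul_assoc,
    ← Complex.ofReal_mul, h3]
  push_cast
  ring

/-- Continuity of the inner product applied to both convergences. The families may differ, and it is
this mixed pairing that links `χ` to `χ'`. -/
theorem tendsto_inner_noiseVec_pow {K : Type*} [NormedAddCommGroup K] [InnerProductSpace ℂ K]
    {π : (k : ℕ) → K →ₗᵢ[ℂ] past n ((2 : ℝ≥0)⁻¹ ^ k)} {χ χ' : Fin (n + 1) → K}
    (hχ : ConvergesToExp π χ) (hχ' : ConvergesToExp π χ') (a b : Fin n → ℂ) :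
    Filter.Tendsto (fun k => inner ℂ (noiseVec χ k a) (noiseVec χ' k b) ^ 2 ^ k) Filter.atTop
      (nhds (Complex.exp (∑ j, inner ℂ (a j) (b j)))) := by
  have h := (hχ a).inner (𝕜 := ℂ) (hχ' b)
  rw [inner_expVec, inner_unitPulse] at h
  refine h.congr fun k => ?_
  rw [inner_sliceTensorPow, LinearIsometry.inner_map_map]

theorem norm_inner_zero_eq_one {K : Type*} [NormedAddCommGroup K] [InnerProductSpace ℂ K]
    {π : (k : ℕ) → K →ₗᵢ[ℂ] past n ((2 : ℝ≥0)⁻¹ ^ k)} {χ χ' : Fin (n + 1) → K}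
    (hχ : ‖χ 0‖ = 1) (hχ_conv : ConvergesToExp π χ)
    (hχ' : ‖χ' 0‖ = 1) (hχ'_conv : ConvergesToExp π χ') : ‖inner ℂ (χ 0) (χ' 0)‖ = 1 := by
  refine norm_eq_one_of_tendsto_pow (tendsto_pow_atTop_atTop_of_one_lt one_lt_two) ?_ ?_
  · exact (norm_inner_le_norm _ _).trans_eq (by rw [hχ, hχ', one_mul])
  · simpa [noiseVec] using tendsto_inner_noiseVec_pow hχ_conv hχ'_conv 0 0

end QFock

/-! ### Identification of the two families up to a phase -/

theorem lemma3 (n : ℕ) {K : Type*} [NormedAddCommGroup K] [InnerProductSpace ℂ K]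
    [CompleteSpace K]
    (π : (k : ℕ) → K →ₗᵢ[ℂ] QFock.past n ((2 : ℝ≥0)⁻¹ ^ k))
    (χ χ' : Fin (n + 1) → K)
    (hχ : Orthonormal ℂ χ) (hχ_conv : QFock.ConvergesToExp π χ)
    (hχ' : Orthonormal ℂ χ') (hχ'_conv : QFock.ConvergesToExp π χ') :
    ∃ φ : ℝ, ∀ j : Fin (n + 1), χ' j = Complex.exp (Complex.I * φ) • χ j := by
  have hc := QFock.norm_inner_zero_eq_one (hχ.1 0) hχ_conv (hχ'.1 0) hχ'_conv
  set c : ℂ := inner ℂ (χ 0) (χ' 0) with hcdef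
  have hc0 : c ≠ 0 := norm_ne_zero_iff.1 (hc ▸ one_ne_zero)
  have h0 : χ' 0 = c • χ 0 := QFock.eq_smul_of_inner_eq (hχ.1 0) (hχ'.1 0) hc rfl
  -- As `χ' 0` and `χ 0` are proportional, orthogonality within each family passes to the mixed
  -- pairs.
  have hl : ∀ j : Fin n, inner ℂ (χ 0) (χ' j.succ) = 0 := fun j => by
    have h : inner ℂ (χ' 0) (χ' j.succ) = 0 := hχ'.2 (Fin.succ_ne_zero j).symm
    rw [h0, inner_smul_left] at h
    exact (mul_eq_zero.1 h).resolve_left (star_ne_zero.2 hc0)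
  have hr : ∀ j : Fin n, inner ℂ (χ j.succ) (χ' 0) = 0 := fun j => by
    rw [h0, inner_smul_right, hχ.2 (Fin.succ_ne_zero j), mul_zero]
  have hpow : Filter.Tendsto (fun k : ℕ => c ^ 2 ^ k) Filter.atTop (nhds 1) := by
    simpa [QFock.noiseVec] using QFock.tendsto_inner_noiseVec_pow hχ_conv hχ'_conv 0 0
  have hexp : ∀ a b : Fin n → ℂ,
      Complex.exp (inner ℂ (∑ j, a j • χ j.succ) (∑ j, b j • χ' j.succ) / c)
        = Complex.exp (∑ j, inner ℂ (a j) (b j)) := fun a b => by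
    refine tendsto_nhds_unique ?_ (QFock.tendsto_inner_noiseVec_pow hχ_conv hχ'_conv a b)
    -- The factorisation `(c + s / 2^k) ^ 2^k = c ^ 2^k * (1 + (s / c) / 2^k) ^ 2^k`; the first
    -- factor tends to `1`, the second to `exp (s / c)`.
    have h := hpow.mul ((Complex.tendsto_one_add_div_pow_exp
      (inner ℂ (∑ j, a j • χ j.succ) (∑ j, b j • χ' j.succ) / c)).comp
      (tendsto_pow_atTop_atTop_of_one_lt one_lt_two))
    rw [one_mul] at h
    refine h.congr fun k => ?_
    rw [QFock.inner_noiseVec hl hr, Function.comp_apply, ← mul_pow, ← hcdef]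
    congr 1
    field_simp
  have hsucc : ∀ j : Fin n, inner ℂ (χ j.succ) (χ' j.succ) = c := fun j => by
    refine (div_eq_one_iff_eq hc0).1 (QFock.eq_of_forall_exp_mul_eq fun t => ?_)
    -- Basis vectors isolate the index `j`; `t` sits in the second argument, where the inner product
    -- is linear.
    have h := hexp (Pi.single j 1) (Pi.single j (t : ℂ))
    simpa [Pi.single_apply, ite_smul, inner_smul_right, mul_div_assoc] using h
  refine ⟨c.arg, fun j => ?_⟩
  have hphase : Complex.exp (Complex.I * c.arg) = c := by
    have h := Complex.norm_mul_exp_arg_mul_I c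
    rwa [hc, Complex.ofReal_one, one_mul, mul_comm] at h
  rw [hphase]
  -- For the index `0` the inner product is `c` by definition.
  exact QFock.eq_smul_of_inner_eq (hχ.1 j) (hχ'.1 j) hc (Fin.cases rfl hsucc j)
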